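/- For a complex matrix \(M\) with \(r\) columns let \(s(M)=(s_1(M),\dots,s_r(M))\) be the vector of its singular values, i.e. the eigenvalues of \((M^*M)^{1/2}\) counted with multiplicity in non-increasing order. For \(x,y\in\mathbb{R}^k\) write \(x\prec_w y\) (submajorization) if \(\sum_{i=1}^{j}x_i^{\downarrow}\le\sum_{i=1}^{j}y_i^{\downarrow}\) for all \(1\le j\le k\), where \(x^{\downarrow}\) is the non-increasing rearrangement of \(x\); if two vectors with non-negative entries have different lengths, the shorter one is first extended by zeros. The product \(x\,y\) of \(x\in\mathbb{R}^k\) and \(y\in\mathbb{R}^r\) is the vector \((x_iy_i)_{1\le i\le\min\{k,r\}}\). Let \(\|\cdot\|\) be the spectral norm, and let \(A\oplus B=\begin{pmatrix}A&0\\0&B\end{pmatrix}\). A norm \(N\) on \(\mathcal{M}_m(\mathbb{C})\) is unitarily invariant if \(N(UMV)=N(M)\) for all \(M\in\mathcal{M}_m(\mathbb{C})\) and all unitary \(U,V\in\mathcal{M}_m(\mathbb{C})\). **Corollary.** Let \(A,B\in\mathcal{M}_n(\mathbb{C})\) be positive semidefinite and let \(X\in\mathcal{M}_n(\mathbb{C})\).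 Then \[ s(AX-XB)\prec_w s(X)\,s(A\oplus B). \] In particular, for every unitarily invariant norm \(N\) on \(\mathcal{M}_{2n}(\mathbb{C})\), \[ N(AX-XB)\le\|X\|\,N(A\oplus B), \] where, as usual, \(N(AX-XB)\) stands for \(N\big((AX-XB)\oplus 0\big)\) with \(0\in\mathcal{M}_n(\mathbb{C})\). -/

import Mathlib

open scoped ComplexOrder

/-- The non-increasing rearrangement `x↓` of a real vector `x`. -/
noncomputable def decreasingRearrangement {k : ℕ} (x : Fin k → ℝ) : Fin k → ℝ :=
  x ∘ Tuple.sort (fun i => -x i)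

/-- The vector `x` extended by zeros to length `m` (used for `k ≤ m` only). -/
noncomputable def zeroPad {k : ℕ} (m : ℕ) (x : Fin k → ℝ) : Fin m → ℝ :=
  fun i => if h : (i : ℕ) < k then x ⟨i, h⟩ else 0

/-- Submajorization `x ≺_w y`: for every `j` the sum of the `j` largest entries of `x` is at most
that of `y`. The shorter vector is first extended by zeros to the length of the longer one; nothing
is added when the lengths agree. -/
def Submajorized {k h : ℕ} (x : Fin k → ℝ) (y : Fin h → ℝ) : Prop :=
  ∀ j : ℕ, j ≤ max k h →
    ∑ i ∈ Finset.univ.filter (fun i : Fin (max k h) => (i : ℕ) < j),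
        decreasingRearrangement (zeroPad (max k h) x) i ≤
      ∑ i ∈ Finset.univ.filter (fun i : Fin (max k h) => (i : ℕ) < j),
        decreasingRearrangement (zeroPad (max k h) y) i

/-- The entrywise product of two vectors, of length the minimum of the two lengths. -/
noncomputable def entrywiseMul {k r : ℕ} (x : Fin k → ℝ) (y : Fin r → ℝ) : Fin (min k r) → ℝ :=
  fun i => x (Fin.castLE (min_le_left k r) i) * y (Fin.castLE (min_le_right k r) i)

/-- The vector `s(M)` of singular values of a complex matrix `M` with columns indexed by `κ`: the
eigenvalues of `(M* M)^(1/2)`, counted with multiplicity, in non-increasing order. -/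
noncomputable def singularVector {ι κ : Type*} [Fintype ι] [Fintype κ] [DecidableEq κ]
    (M : Matrix ι κ ℂ) : Fin (Fintype.card κ) → ℝ :=
  fun i => (Matrix.toEuclideanLin M).singularValues i

/-- The spectral norm of a square complex matrix: its operator norm for the Euclidean norm. -/
noncomputable def matrixSpectralNorm {ι : Type*} [Fintype ι] [DecidableEq ι] (M : Matrix ι ι ℂ) : ℝ :=
  ‖Matrix.toEuclideanCLM (𝕜 := ℂ) M‖

/-- The direct sum `A ⊕ B`, that is, the block diagonal matrix with diagonal blocks `A`, `B`. -/
def matrixDirectSum {ι κ : Type*} (A : Matrix ι ι ℂ) (B : Matrix κ κ ℂ) :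
    Matrix (ι ⊕ κ) (ι ⊕ κ) ℂ :=
  Matrix.fromBlocks A 0 0 B

/-- `N` is a norm on the square complex matrices indexed by `ι` (a seminorm vanishing only at `0`)
with `N (U M V) = N M` for all unitary `U`, `V`. -/
structure IsUnitarilyInvariantNorm {ι : Type*} [Fintype ι] [DecidableEq ι]
    (N : Seminorm ℂ (Matrix ι ι ℂ)) : Prop where
  eq_zero_of_apply_eq_zero : ∀ M : Matrix ι ι ℂ, N M = 0 → M = 0
  unitary_mul_mul_unitary : ∀ M U V : Matrix ι ι ℂ,
    U ∈ Matrix.unitaryGroup ι ℂ → V ∈ Matrix.unitaryGroup ι ℂ → N (U * M * V) = N M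

/-! Majorization. By Ky Fan's principle the sum of the `k` largest singular values is the maximum of
`∑ Re ⟪u i, T (v i)⟫` over orthonormal `k`-families. Spectral decomposition of `A` and `B` writes
`AX - XB` as a sum of rank-one operators weighted by the `2n` eigenvalues of `A ⊕ B`. Abel summation
over the sorted weights reduces the estimate to `PX - XQ`, with `P`, `Q` orthogonal projections of
total rank at most `l`. Since `PX - XQ = ½((2P-1)X - X(2Q-1))` and reflections are unitary, its Ky
Fan sums are at most those of `X`, and its rank leaves only `min k l` terms
(`sum_re_inner_starProjection_comm_le_min`). A second Abel summation replaces the eigenvalues by the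
singular values of `A ⊕ B`.

Norm inequality. This is proved independently of the majorization. A contraction is the mean of two
unitaries, so `X` may be taken unitary; then `AU - UB = (A - UBU*)U` reduces the claim to `N((A-B) ⊕
0) ≤ N(A ⊕ B)` (`directSum_sub_zero_le`). With `P` the positive spectral projection of `A - B` and
`Q = 1 - P`, one has `|A-B| ≤ PAP + QBQ`, and the right side is a compression of `A ⊕ B` by a
contraction. -/

open scoped InnerProductSpace

/-! ### Singular value decomposition, Ky Fan's principle, and the case of projections -/

section SingularValues

variable {E : Type*} [NormedAddCommGroup E] [InnerProductSpace ℂ E] [FiniteDimensional ℂ E]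

/-- The singular value decomposition of an endomorphism of a finite-dimensional space. -/
theorem LinearMap.exists_orthonormalBasis_apply_eq_singularValues_smul {n : ℕ}
    (hn : Module.finrank ℂ E = n) (T : E →ₗ[ℂ] E) :
    ∃ e f : OrthonormalBasis (Fin n) ℂ E, ∀ i, T (e i) = (T.singularValues i : ℂ) • f i := by
  set hT := T.isSymmetric_adjoint_comp_self
  set e := hT.eigenvectorBasis hn
  have hinner : ∀ i j, ⟪T (e i), T (e j)⟫_ℂ = (T.singularValues j ^ 2 : ℝ) * ⟪e i, e j⟫_ℂ := by
    intro i j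
    rw [← LinearMap.adjoint_inner_right, ← LinearMap.comp_apply, hT.apply_eigenvectorBasis hn j,
      inner_smul_right, T.sq_singularValues_fin hn j]
    rfl
  have horth : Pairwise fun i j => ⟪T (e i), T (e j)⟫_ℂ = 0 := by
    intro i j hij
    simp only [hinner, e.orthonormal.2 hij, mul_zero]
  have hnorm : ∀ i, ‖T (e i)‖ = T.singularValues i := by
    intro i
    have h := hinner i i
    rw [inner_self_eq_norm_sq_to_K, inner_self_eq_norm_sq_to_K, e.norm_eq_one i] at h
    have h' : ‖T (e i)‖ ^ 2 = T.singularValues i ^ 2 := by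
      have := congrArg Complex.re h
      simpa [← Complex.ofReal_pow] using this
    exact (sq_eq_sq₀ (norm_nonneg _) (T.singularValues_nonneg i)).1 h'
  -- The vectors `T (e i)` are orthogonal but may vanish; Gram–Schmidt normalizes the nonzero ones
  -- and completes them to a basis.
  refine ⟨e, InnerProductSpace.gramSchmidtOrthonormalBasis (by simpa using hn)
    (fun i => T (e i)), fun i => ?_⟩
  by_cases h0 : T (e i) = 0
  · rw [← hnorm i, h0]; simp
  · rw [InnerProductSpace.gramSchmidtOrthonormalBasis_apply_of_orthogonal _ horth h0, ← hnorm i,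
      smul_smul]
    have : (‖T (e i)‖ : ℂ) ≠ 0 := by simpa using h0
    have h1 : (‖T (e i)‖ : ℂ) * (‖T (e i)‖ : ℂ)⁻¹ = 1 := mul_inv_cancel₀ this
    exact ((congrArg (· • T (e i)) h1).trans (one_smul ℂ _)).symm

/-- An antitone sequence weighted by weights in `[0, 1]` of total mass at most `k` sums to at most
the sum of the first `k` terms. -/
theorem sum_mul_le_sum_range_of_antitone {s : ℕ → ℝ} (hs : Antitone s) (hs0 : ∀ i, 0 ≤ s i)
    {n k : ℕ} {w : Fin n → ℝ} (hw0 : ∀ i, 0 ≤ w i) (hw1 : ∀ i, w i ≤ 1) (hw : ∑ i, w i ≤ k) :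
    ∑ i : Fin n, s i * w i ≤ ∑ i ∈ Finset.range k, s i := by
  -- After subtracting the threshold `s k`, terms before `k` are nonnegative and the others
  -- nonpositive, so weights 1 and 0 are optimal.
  have h1 : ∑ i : Fin n, (s i - s k) * w i ≤ ∑ i : Fin n, if (i : ℕ) < k then s i - s k else 0 := by
    refine Finset.sum_le_sum fun i _ => ?_
    split_ifs with h
    · have := hs h.le
      nlinarith [hw1 i]
    · have := hs (not_lt.1 h)
      nlinarith [hw0 i]
  have h2 : ∑ i : Fin n, (if (i : ℕ) < k then s i - s k else 0) ≤
      ∑ i ∈ Finset.range k, (s i - s k) := by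
    rw [Fin.sum_univ_eq_sum_range (fun i => if i < k then s i - s k else 0) n, ← Finset.sum_filter]
    refine Finset.sum_le_sum_of_subset_of_nonneg (fun i hi => ?_) fun i hi _ => ?_
    · simpa using (Finset.mem_filter.1 hi).2
    · exact sub_nonneg.2 (hs (Finset.mem_range.1 hi).le)
  have h3 : ∑ i : Fin n, s i * w i = ∑ i : Fin n, (s i - s k) * w i + s k * ∑ i, w i := by
    rw [Finset.mul_sum, ← Finset.sum_add_distrib]
    exact Finset.sum_congr rfl fun i _ => by ring
  have h4 : ∑ i ∈ Finset.range k, (s i - s k) = ∑ i ∈ Finset.range k, s i - k * s k := by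
    simp [Finset.sum_sub_distrib]
  nlinarith [hs0 k]

/-- Ky Fan's inequality. -/
theorem LinearMap.sum_re_inner_le_sum_singularValues (T : E →ₗ[ℂ] E) {k : ℕ} {u v : Fin k → E}
    (hu : Orthonormal ℂ u) (hv : Orthonormal ℂ v) :
    ∑ i, (⟪u i, T (v i)⟫_ℂ).re ≤ ∑ i ∈ Finset.range k, T.singularValues i := by
  obtain ⟨e, f, hef⟩ := T.exists_orthonormalBasis_apply_eq_singularValues_smul rfl
  -- Weights from `xy ≤ (x² + y²)/2`: Bessel bounds each by 1, and Parseval makes their total `k`.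
  set w : Fin (Module.finrank ℂ E) → ℝ :=
    fun l => ∑ i, (‖⟪e l, v i⟫_ℂ‖ ^ 2 + ‖⟪u i, f l⟫_ℂ‖ ^ 2) / 2 with hwdef
  have hTv : ∀ i, ⟪u i, T (v i)⟫_ℂ =
      ∑ l : Fin (Module.finrank ℂ E), (T.singularValues l : ℂ) * (⟪e l, v i⟫_ℂ * ⟪u i, f l⟫_ℂ) := by
    intro i
    conv_lhs => rw [← e.sum_repr' (v i)]
    rw [map_sum, inner_sum]
    refine Finset.sum_congr rfl fun l _ => ?_
    rw [map_smul, hef, inner_smul_right, inner_smul_right]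
    ring
  have hterm : ∀ i, (⟪u i, T (v i)⟫_ℂ).re ≤
      ∑ l : Fin (Module.finrank ℂ E), T.singularValues l * ((‖⟪e l, v i⟫_ℂ‖ ^ 2 + ‖⟪u i, f l⟫_ℂ‖ ^ 2) / 2) := by
    intro i
    rw [hTv, Complex.re_sum]
    refine Finset.sum_le_sum fun l _ => ?_
    rw [Complex.re_ofReal_mul]
    refine mul_le_mul_of_nonneg_left ?_ (T.singularValues_nonneg l)
    refine (Complex.re_le_norm _).trans ?_
    rw [norm_mul]
    nlinarith [sq_nonneg (‖⟪e l, v i⟫_ℂ‖ - ‖⟪u i, f l⟫_ℂ‖)]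
  have hsum : ∑ i, (⟪u i, T (v i)⟫_ℂ).re ≤
      ∑ l : Fin (Module.finrank ℂ E), T.singularValues l * w l := by
    refine (Finset.sum_le_sum fun i _ => hterm i).trans_eq ?_
    rw [Finset.sum_comm]
    exact Finset.sum_congr rfl fun l _ => by rw [hwdef, Finset.mul_sum]
  refine hsum.trans (sum_mul_le_sum_range_of_antitone T.singularValues_antitone
    T.singularValues_nonneg (fun l => ?_) (fun l => ?_) ?_)
  · exact Finset.sum_nonneg fun i _ => by positivity
  · have h1 := hv.sum_inner_products_le (e l) (s := Finset.univ)
    have h2 := hu.sum_inner_products_le (f l) (s := Finset.univ)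
    rw [e.norm_eq_one] at h1
    rw [f.norm_eq_one] at h2
    simp only [hwdef]
    rw [← Finset.sum_div, Finset.sum_add_distrib]
    simp only [norm_inner_symm (v _)] at h1
    linarith
  · simp only [hwdef]
    rw [Finset.sum_comm]
    have : ∀ i : Fin k, ∑ l, (‖⟪e l, v i⟫_ℂ‖ ^ 2 + ‖⟪u i, f l⟫_ℂ‖ ^ 2) / 2 = 1 := by
      intro i
      rw [← Finset.sum_div, Finset.sum_add_distrib, e.sum_sq_norm_inner_right,
        f.sum_sq_norm_inner_left, hu.1 i, hv.1 i]
      norm_num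
    simp [this]

theorem LinearMap.sum_range_min_finrank_singularValues (T : E →ₗ[ℂ] E) {k m : ℕ}
    (hm : Module.finrank ℂ T.range ≤ m) :
    ∑ i ∈ Finset.range k, T.singularValues i =
      ∑ i ∈ Finset.range (min k m), T.singularValues i := by
  symm
  refine Finset.sum_subset (fun i hi => by simp at hi ⊢; omega) fun i hi hi' => ?_
  rw [T.singularValues_eq_zero_iff_le_finrank_range]
  simp at hi hi'
  omega

/-- Any Ky Fan sum is attained by the singular vectors. -/
theorem LinearMap.exists_orthonormal_sum_re_inner_eq (T : E →ₗ[ℂ] E) {k : ℕ}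
    (hk : k ≤ Module.finrank ℂ E) :
    ∃ u v : Fin k → E, Orthonormal ℂ u ∧ Orthonormal ℂ v ∧
      ∑ i, (⟪u i, T (v i)⟫_ℂ).re = ∑ i ∈ Finset.range k, T.singularValues i := by
  obtain ⟨e, f, hef⟩ := T.exists_orthonormalBasis_apply_eq_singularValues_smul rfl
  refine ⟨f ∘ Fin.castLE hk, e ∘ Fin.castLE hk, f.orthonormal.comp _ (Fin.castLE_injective hk),
    e.orthonormal.comp _ (Fin.castLE_injective hk), ?_⟩
  rw [← Fin.sum_univ_eq_sum_range]
  refine Finset.sum_congr rfl fun i _ => ?_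
  simp [hef, inner_self_eq_norm_sq_to_K]

/-- Half the difference of two reflected copies of `X`: one reflection is moved onto `u`, the other,
with its sign, onto `v`, and Ky Fan's inequality applies to each. -/
theorem sum_re_inner_starProjection_comm_le (X : E →ₗ[ℂ] E) (K L : Submodule ℂ E) {k : ℕ}
    {u v : Fin k → E} (hu : Orthonormal ℂ u) (hv : Orthonormal ℂ v) :
    ∑ i, (⟪u i, K.starProjection (X (v i)) - X (L.starProjection (v i))⟫_ℂ).re ≤
      ∑ i ∈ Finset.range k, X.singularValues i := by
  have h1 := X.sum_re_inner_le_sum_singularValues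
    (hu.comp_linearIsometryEquiv K.reflection) hv
  have hv' : Orthonormal ℂ fun i => -(L.reflection (v i)) :=
    hv.comp_linearIsometryEquiv (L.reflection.trans (LinearIsometryEquiv.neg ℂ))
  have h2 := X.sum_re_inner_le_sum_singularValues hu hv'
  have h3 : ∀ i, (⟪u i, K.starProjection (X (v i)) - X (L.starProjection (v i))⟫_ℂ).re =
      ((⟪K.reflection (u i), X (v i)⟫_ℂ).re + (⟪u i, X (-(L.reflection (v i)))⟫_ℂ).re) / 2 := by
    intro i
    rw [Submodule.reflection_apply, Submodule.reflection_apply, inner_sub_left, inner_sub_right,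
      ← Submodule.inner_starProjection_left_eq_right]
    simp only [two_smul, neg_sub, map_sub, map_add, inner_sub_right, inner_add_left,
      inner_add_right, Complex.sub_re, Complex.add_re]
    ring
  simp only [h3]
  rw [← Finset.sum_div, Finset.sum_add_distrib]
  simp only [Function.comp_apply] at h1
  linarith

/-- The range lies in `K ⊔ X(L)`, so at most `m` singular values are nonzero. Their sum is attained
on families of length `min k m`, where the previous bound applies. -/
theorem sum_re_inner_starProjection_comm_le_min (X : E →ₗ[ℂ] E) (K L : Submodule ℂ E) {k m : ℕ}
    (hm : Module.finrank ℂ K + Module.finrank ℂ L ≤ m) (hk : k ≤ Module.finrank ℂ E)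
    {u v : Fin k → E} (hu : Orthonormal ℂ u) (hv : Orthonormal ℂ v) :
    ∑ i, (⟪u i, K.starProjection (X (v i)) - X (L.starProjection (v i))⟫_ℂ).re ≤
      ∑ i ∈ Finset.range (min k m), X.singularValues i := by
  set M : E →ₗ[ℂ] E := (K.starProjection : E →ₗ[ℂ] E) ∘ₗ X - X ∘ₗ (L.starProjection : E →ₗ[ℂ] E)
  have hrank : Module.finrank ℂ M.range ≤ m := by
    have hle : M.range ≤ K ⊔ L.map X := by
      rintro _ ⟨x, rfl⟩
      refine Submodule.sub_mem _ (Submodule.mem_sup_left ?_) (Submodule.mem_sup_right ?_)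
      · exact Submodule.starProjection_apply_mem _ _
      · exact Submodule.mem_map_of_mem (Submodule.starProjection_apply_mem _ _)
    refine (Submodule.finrank_mono hle).trans ((Submodule.finrank_add_le_finrank_add_finrank _ _).trans ?_)
    exact (Nat.add_le_add_left (Submodule.finrank_map_le X L) _).trans hm
  have h1 := M.sum_re_inner_le_sum_singularValues hu hv
  rw [M.sum_range_min_finrank_singularValues hrank] at h1
  refine h1.trans ?_
  obtain ⟨u', v', hu', hv', h⟩ :=
    M.exists_orthonormal_sum_re_inner_eq (k := min k m) ((min_le_left _ _).trans hk)
  rw [← h]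
  exact sum_re_inner_starProjection_comm_le X K L hu' hv'

end SingularValues

/-! ### Abel summation and the Ky Fan sums of `AX - XB` -/

/-- Summation by parts: domination of partial sums is preserved by antitone nonnegative weights. -/
theorem sum_range_mul_le_of_antitone {c r y : ℕ → ℝ} (hc : Antitone c) (hc0 : ∀ i, 0 ≤ c i) {N : ℕ}
    (h : ∀ l ≤ N, ∑ i ∈ Finset.range l, r i ≤ ∑ i ∈ Finset.range l, y i) :
    ∑ i ∈ Finset.range N, c i * r i ≤ ∑ i ∈ Finset.range N, c i * y i := by
  have key : ∀ m ≤ N, c m * (∑ i ∈ Finset.range m, y i - ∑ i ∈ Finset.range m, r i) ≤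
      ∑ i ∈ Finset.range m, c i * y i - ∑ i ∈ Finset.range m, c i * r i := by
    intro m
    induction m with
    | zero => simp
    | succ m ih =>
      intro hm
      have h1 := ih (Nat.le_of_succ_le hm)
      have h2 := h _ hm
      have h3 := hc (Nat.le_succ m)
      simp only [Finset.sum_range_succ] at h2 ⊢
      have h4 := mul_nonneg (sub_nonneg.2 h3) (sub_nonneg.2 h2)
      simp only [Nat.succ_eq_add_one] at h4
      nlinarith
  have h1 := key N le_rfl
  have h2 := mul_nonneg (hc0 N) (sub_nonneg.2 (h N le_rfl))
  linarith

theorem exists_equiv_antitone {ι : Type*} [Fintype ι] {N : ℕ} (hN : Fintype.card ι = N)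
    (μ : ι → ℝ) : ∃ e : Fin N ≃ ι, Antitone (μ ∘ e) := by
  let e0 := (Fintype.equivFinOfCardEq hN).symm
  refine ⟨(Tuple.sort fun i => -μ (e0 i)).trans e0, fun i j hij => ?_⟩
  have := Tuple.monotone_sort (fun i => -μ (e0 i)) hij
  simpa using this

section SingularValues

variable {E : Type*} [NormedAddCommGroup E] [InnerProductSpace ℂ E] [FiniteDimensional ℂ E]

theorem OrthonormalBasis.starProjection_span_image {ι : Type*} [Fintype ι] [DecidableEq ι]
    (a : OrthonormalBasis ι ℂ E) (S : Finset ι) (x : E) :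
    (Submodule.span ℂ (a '' S)).starProjection x = ∑ i ∈ S, ⟪a i, x⟫_ℂ • a i := by
  refine Submodule.eq_starProjection_of_mem_of_inner_eq_zero ?_ fun w hw => ?_
  · exact Submodule.sum_mem _ fun i hi =>
      Submodule.smul_mem _ _ (Submodule.subset_span ⟨i, hi, rfl⟩)
  · induction hw using Submodule.span_induction with
    | mem w hw =>
      obtain ⟨j, hj, rfl⟩ := hw
      rw [inner_sub_left, sum_inner]
      simp only [inner_smul_left, inner_conj_symm, a.inner_eq_ite, mul_ite, mul_one, mul_zero]
      rw [Finset.sum_ite_eq' S j, if_pos (by exact_mod_cast hj), sub_self]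
    | zero => simp
    | add u v _ _ hu hv => rw [inner_add_right, hu, hv, add_zero]
    | smul c u _ hu => rw [inner_smul_right, hu, mul_zero]

omit [FiniteDimensional ℂ E] in
theorem finrank_span_image_le_card {ι : Type*} (a : ι → E) (S : Finset ι) :
    Module.finrank ℂ (Submodule.span ℂ (a '' S)) ≤ S.card := by
  classical
  rw [← Finset.coe_image]
  exact (finrank_span_finset_le_card _).trans Finset.card_image_le

/-- The Ky Fan sums of `AX - XB` are controlled by the singular values of `X` and the jointly sorted
eigenvalues of `A` and `B`. -/
theorem sum_singularValues_comm_le_sum_mul {n N : ℕ} (hn : Module.finrank ℂ E = n)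
    {A B : E →ₗ[ℂ] E} (X : E →ₗ[ℂ] E) (a b : OrthonormalBasis (Fin n) ℂ E) {α β : Fin n → ℝ}
    (hA : ∀ i, A (a i) = (α i : ℂ) • a i) (hB : ∀ i, B (b i) = (β i : ℂ) • b i)
    (e : Fin N ≃ Fin n ⊕ Fin n) {c : ℕ → ℝ} (hc : Antitone c) (hc0 : ∀ i, 0 ≤ c i)
    (hce : ∀ i : Fin N, c i = Sum.elim α β (e i)) {k : ℕ} (hk : k ≤ n) :
    ∑ i ∈ Finset.range k, (A ∘ₗ X - X ∘ₗ B).singularValues i ≤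
      ∑ i ∈ Finset.range k, X.singularValues i * c i := by
  have hNn : N = n + n := by simpa using Fintype.card_congr e
  obtain ⟨u, v, hu, hv, huv⟩ :=
    (A ∘ₗ X - X ∘ₗ B).exists_orthonormal_sum_re_inner_eq (k := k) (hn ▸ hk)
  rw [← huv]
  -- The minus sign of `XB` is absorbed into `R`, so the weights remain the nonnegative eigenvalues.
  let R : Fin n ⊕ Fin n → E → E :=
    Sum.elim (fun i x => ⟪a i, X x⟫_ℂ • a i) (fun j x => -X (⟪b j, x⟫_ℂ • b j))
  let ρ : Fin n ⊕ Fin n → ℝ := fun p => ∑ i, (⟪u i, R p (v i)⟫_ℂ).re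
  have hdecomp : ∀ x, (A ∘ₗ X - X ∘ₗ B) x = ∑ p, ((Sum.elim α β p : ℝ) : ℂ) • R p x := by
    intro x
    rw [Fintype.sum_sum_type]
    simp only [Sum.elim_inl, Sum.elim_inr, R, smul_neg, Finset.sum_neg_distrib]
    rw [← sub_eq_add_neg, LinearMap.sub_apply, LinearMap.comp_apply, LinearMap.comp_apply]
    congr 1
    · conv_lhs => rw [← a.sum_repr' (X x)]
      simp only [map_sum, map_smul, hA]
      exact Finset.sum_congr rfl fun i _ => smul_comm _ _ _
    · conv_lhs => rw [← b.sum_repr' x]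
      simp only [map_sum, map_smul, hB]
      exact Finset.sum_congr rfl fun i _ => smul_comm _ _ _
  have hlhs : ∑ i, (⟪u i, (A ∘ₗ X - X ∘ₗ B) (v i)⟫_ℂ).re = ∑ p, Sum.elim α β p * ρ p := by
    simp only [hdecomp, inner_sum, inner_smul_right, Complex.re_sum, Complex.re_ofReal_mul, ρ,
      Finset.mul_sum]
    exact Finset.sum_comm
  let r : ℕ → ℝ := fun l => if h : l < N then ρ (e ⟨l, h⟩) else 0
  let y : ℕ → ℝ := fun l => if l < k then X.singularValues l else 0
  have hsumr : ∑ p, Sum.elim α β p * ρ p = ∑ i ∈ Finset.range N, c i * r i := by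
    rw [← Fin.sum_univ_eq_sum_range (fun i => c i * r i) N,
      ← Equiv.sum_comp e (fun p => Sum.elim α β p * ρ p)]
    refine Finset.sum_congr rfl fun i _ => ?_
    simp [r, hce]
  have hy : ∀ l, ∑ i ∈ Finset.range l, y i = ∑ i ∈ Finset.range (min k l), X.singularValues i := by
    intro l
    simp only [y]
    rw [← Finset.sum_filter]
    refine Finset.sum_congr ?_ fun _ _ => rfl
    ext i
    simp only [Finset.mem_filter, Finset.mem_range]
    omega
  have hsumy : ∑ i ∈ Finset.range N, c i * y i =
      ∑ i ∈ Finset.range k, X.singularValues i * c i := by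
    simp only [y, mul_ite, mul_zero]
    rw [← Finset.sum_filter]
    refine Finset.sum_congr ?_ fun _ _ => mul_comm _ _
    ext i
    simp only [Finset.mem_filter, Finset.mem_range]
    omega
  rw [hlhs, hsumr, ← hsumy]
  refine sum_range_mul_le_of_antitone hc hc0 fun l hl => ?_
  rw [hy]
  -- The `l` largest joint eigenvalues split into those of `A` and those of `B`; the corresponding
  -- rank-one terms add up to `PX - XQ` with spectral projections.
  let S : Finset (Fin n) := Finset.univ.filter fun i => (e.symm (Sum.inl i) : ℕ) < l
  let T : Finset (Fin n) := Finset.univ.filter fun i => (e.symm (Sum.inr i) : ℕ) < l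
  have hsplit : ∀ g : Fin n ⊕ Fin n → ℝ, ∑ i : Fin N, (if (i : ℕ) < l then g (e i) else 0) =
      ∑ i ∈ S, g (Sum.inl i) + ∑ i ∈ T, g (Sum.inr i) := by
    intro g
    rw [← Equiv.sum_comp e.symm, Fintype.sum_sum_type]
    simp only [Equiv.apply_symm_apply, S, T, Finset.sum_filter]
  have hcard : S.card + T.card = l := by
    have h1 := hsplit fun _ => 1
    rw [Fin.sum_univ_eq_sum_range (fun i => if i < l then (1 : ℝ) else 0) N,
      ← Finset.sum_filter] at h1
    have h2 : (Finset.range N).filter (· < l) = Finset.range l := by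
      ext i
      simp only [Finset.mem_filter, Finset.mem_range]
      omega
    rw [h2] at h1
    simp only [Finset.sum_const, Finset.card_range, nsmul_eq_mul, mul_one] at h1
    exact_mod_cast h1.symm
  have hpartial : ∑ i ∈ Finset.range l, r i = ∑ i ∈ S, ρ (Sum.inl i) + ∑ i ∈ T, ρ (Sum.inr i) := by
    rw [← hsplit]
    have h2 : Finset.range l = (Finset.range N).filter (· < l) := by
      ext i
      simp only [Finset.mem_filter, Finset.mem_range]
      omega
    rw [h2, Finset.sum_filter, ← Fin.sum_univ_eq_sum_range (fun i => if i < l then r i else 0)]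
    refine Finset.sum_congr rfl fun i _ => ?_
    simp [r]
  have hproj : ∑ i ∈ S, ρ (Sum.inl i) + ∑ i ∈ T, ρ (Sum.inr i) =
      ∑ i, (⟪u i, (Submodule.span ℂ (a '' S)).starProjection (X (v i)) -
        X ((Submodule.span ℂ (b '' T)).starProjection (v i))⟫_ℂ).re := by
    simp only [ρ]
    rw [Finset.sum_comm, Finset.sum_comm (s := T), ← Finset.sum_add_distrib]
    refine Finset.sum_congr rfl fun i _ => ?_
    rw [a.starProjection_span_image, b.starProjection_span_image, inner_sub_right, map_sum,
      inner_sum, inner_sum, Complex.sub_re, Complex.re_sum, Complex.re_sum, sub_eq_add_neg,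
      ← Finset.sum_neg_distrib]
    simp [R]
  rw [hpartial, hproj]
  refine sum_re_inner_starProjection_comm_le_min X _ _ ?_ (hn ▸ hk) hu hv
  rw [← hcard]
  exact add_le_add (finrank_span_image_le_card _ _) (finrank_span_image_le_card _ _)

/-- The Ky Fan sums of `AX - XB` are controlled by the singular values of `X` and those of any
operator `D` that has the eigenvalues of `A` and `B` on an orthonormal family. -/
theorem sum_singularValues_comm_le {F : Type*} [NormedAddCommGroup F] [InnerProductSpace ℂ F]
    [FiniteDimensional ℂ F] {n : ℕ} (hn : Module.finrank ℂ E = n)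
    {A B : E →ₗ[ℂ] E} (X : E →ₗ[ℂ] E) (a b : OrthonormalBasis (Fin n) ℂ E) {α β : Fin n → ℝ}
    (hA : ∀ i, A (a i) = (α i : ℂ) • a i) (hB : ∀ i, B (b i) = (β i : ℂ) • b i)
    (hα : ∀ i, 0 ≤ α i) (hβ : ∀ i, 0 ≤ β i) {D : F →ₗ[ℂ] F} {w : Fin n ⊕ Fin n → F}
    (hw : Orthonormal ℂ w) (hD : ∀ p, D (w p) = ((Sum.elim α β p : ℝ) : ℂ) • w p)
    {k : ℕ} (hk : k ≤ n) :
    ∑ i ∈ Finset.range k, (A ∘ₗ X - X ∘ₗ B).singularValues i ≤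
      ∑ i ∈ Finset.range k, X.singularValues i * D.singularValues i := by
  obtain ⟨e, he⟩ := exists_equiv_antitone (N := n + n) (by simp) (Sum.elim α β)
  have hμ : ∀ p, 0 ≤ Sum.elim α β p := by
    rintro (i | i)
    exacts [hα i, hβ i]
  let c : ℕ → ℝ := fun l => if h : l < n + n then Sum.elim α β (e ⟨l, h⟩) else 0
  have hc0 : ∀ i, 0 ≤ c i := by
    intro i
    simp only [c]
    split_ifs
    exacts [hμ _, le_rfl]
  have hc : Antitone c := by
    intro i j hij
    by_cases hj : j < n + n
    · simp only [c, dif_pos hj, dif_pos (hij.trans_lt hj)]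
      exact he hij
    · simpa only [c, dif_neg hj] using hc0 i
  have hce : ∀ i : Fin (n + n), c i = Sum.elim α β (e i) := fun i => by simp [c]
  refine (sum_singularValues_comm_le_sum_mul hn X a b hA hB e hc hc0 hce hk).trans ?_
  -- Now the singular values of `X` are the weights; partial sums of `c` are bounded by Ky Fan's
  -- inequality for `D`, tested on its top eigenvectors in `w`.
  refine sum_range_mul_le_of_antitone X.singularValues_antitone X.singularValues_nonneg
    fun l hl => ?_
  have hln : l ≤ n + n := by omega
  have hwe : Orthonormal ℂ fun i : Fin l => w (e (Fin.castLE hln i)) :=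
    hw.comp _ (e.injective.comp (Fin.castLE_injective hln))
  refine le_of_eq_of_le ?_ (D.sum_re_inner_le_sum_singularValues hwe hwe)
  rw [← Fin.sum_univ_eq_sum_range]
  refine Finset.sum_congr rfl fun i _ => ?_
  rw [hD, inner_smul_right, inner_self_eq_norm_sq_to_K, hw.1, ← hce]
  simp

end SingularValues

/-! ### From Ky Fan sums to submajorization -/

theorem decreasingRearrangement_of_antitone {k : ℕ} {x : Fin k → ℝ} (hx : Antitone x) :
    decreasingRearrangement x = x := by
  have : Tuple.sort (fun i => -x i) = Equiv.refl _ :=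
    Tuple.sort_eq_refl_iff_monotone.2 fun i j hij => neg_le_neg (hx hij)
  rw [decreasingRearrangement, this]
  rfl

/-- Nonnegativity keeps the zero-padded vector antitone, so the rearrangement does nothing. -/
theorem sum_decreasingRearrangement_zeroPad {s : ℕ → ℝ} (hs : Antitone s) (hs0 : ∀ i, 0 ≤ s i)
    {k m : ℕ} (hkm : k ≤ m) {x : Fin k → ℝ} (hx : ∀ i : Fin k, x i = s i) (j : ℕ) :
    ∑ i ∈ Finset.univ.filter (fun i : Fin m => (i : ℕ) < j),
      decreasingRearrangement (zeroPad m x) i = ∑ i ∈ Finset.range (min j k), s i := by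
  have hpad : zeroPad m x = fun i : Fin m => if (i : ℕ) < k then s i else 0 := by
    funext i
    simp only [zeroPad]
    split_ifs with h
    · exact hx ⟨i, h⟩
    · rfl
  have hanti : Antitone (zeroPad m x) := by
    intro i i' hii'
    rw [hpad]
    dsimp only
    split_ifs with h1 h2
    · exact hs hii'
    · exact absurd (lt_of_le_of_lt (Fin.le_def.1 hii') h1) h2
    · exact hs0 _
    · exact le_rfl
  rw [decreasingRearrangement_of_antitone hanti, hpad, Finset.sum_filter,
    Fin.sum_univ_eq_sum_range (fun i => if i < j then (if i < k then s i else 0) else 0) m]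
  simp only [← ite_and]
  rw [← Finset.sum_filter]
  refine Finset.sum_congr ?_ fun _ _ => rfl
  ext i
  simp only [Finset.mem_filter, Finset.mem_range]
  omega

theorem submajorized_of_antitone {s t : ℕ → ℝ} (hs : Antitone s) (hs0 : ∀ i, 0 ≤ s i)
    (ht : Antitone t) (ht0 : ∀ i, 0 ≤ t i) {k h : ℕ} {x : Fin k → ℝ} {y : Fin h → ℝ}
    (hx : ∀ i : Fin k, x i = s i) (hy : ∀ i : Fin h, y i = t i) (hkh : k ≤ h)
    (hle : ∀ l ≤ k, ∑ i ∈ Finset.range l, s i ≤ ∑ i ∈ Finset.range l, t i) :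
    Submajorized x y := by
  intro j _
  rw [sum_decreasingRearrangement_zeroPad hs hs0 (le_max_left k h) hx,
    sum_decreasingRearrangement_zeroPad ht ht0 (le_max_right k h) hy]
  refine (hle _ (min_le_right _ _)).trans ?_
  refine Finset.sum_le_sum_of_subset_of_nonneg (fun i hi => ?_) fun i _ _ => ht0 i
  simp only [Finset.mem_range] at hi ⊢
  omega

/-- Applied to eigenbases of `A` and `B`, this supplies the orthonormal eigenvectors of `A ⊕ B`. -/
theorem orthonormal_sumElim_toLp {ι κ n m : Type*} [Fintype ι] [Fintype κ]
    {a : n → EuclideanSpace ℂ ι} {b : m → EuclideanSpace ℂ κ}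
    (ha : Orthonormal ℂ a) (hb : Orthonormal ℂ b) :
    Orthonormal ℂ (Sum.elim (fun i => WithLp.toLp 2 (Sum.elim (a i) 0))
      (fun j => WithLp.toLp 2 (Sum.elim 0 (b j))) : n ⊕ m → EuclideanSpace ℂ (ι ⊕ κ)) := by
  classical
  rw [orthonormal_iff_ite] at ha hb ⊢
  rintro (i | i) (j | j)
  · have := ha i j
    simp only [PiLp.inner_apply] at this
    simp [PiLp.inner_apply, Fintype.sum_sum_type] at this ⊢
    exact this
  · simp [PiLp.inner_apply, Fintype.sum_sum_type]
  · simp [PiLp.inner_apply, Fintype.sum_sum_type]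
  · have := hb i j
    simp only [PiLp.inner_apply] at this
    simp [PiLp.inner_apply, Fintype.sum_sum_type] at this ⊢
    exact this

theorem Matrix.IsHermitian.toEuclideanLin_eigenvectorBasis {ι : Type*} [Fintype ι] [DecidableEq ι]
    {A : Matrix ι ι ℂ} (hA : A.IsHermitian) (i : ι) :
    Matrix.toEuclideanLin A (hA.eigenvectorBasis i) =
      (hA.eigenvalues i : ℂ) • hA.eigenvectorBasis i := by
  refine (WithLp.ofLp_injective 2) ?_
  rw [Matrix.ofLp_toLpLin, Matrix.toLin'_apply, hA.mulVec_eigenvectorBasis]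
  rfl

theorem submajorized_singularVector_comm (n : ℕ) (A B X : Matrix (Fin n) (Fin n) ℂ)
    (hA : A.PosSemidef) (hB : B.PosSemidef) :
    Submajorized (singularVector (A * X - X * B))
      (entrywiseMul (singularVector X) (singularVector (matrixDirectSum A B))) := by
  set D := Matrix.toEuclideanLin (matrixDirectSum A B)
  set T := Matrix.toEuclideanLin X
  refine submajorized_of_antitone (Matrix.toEuclideanLin (A * X - X * B)).singularValues_antitone
    (LinearMap.singularValues_nonneg _) (t := fun i => T.singularValues i * D.singularValues i)
    (fun i j hij => mul_le_mul (T.singularValues_antitone hij) (D.singularValues_antitone hij)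
      (D.singularValues_nonneg _) (T.singularValues_nonneg _))
    (fun i => mul_nonneg (T.singularValues_nonneg _) (D.singularValues_nonneg _))
    (fun _ => rfl) (fun _ => rfl) (by simp) fun l hl => ?_
  have hlin : Matrix.toEuclideanLin (A * X - X * B) =
      Matrix.toEuclideanLin A ∘ₗ T - T ∘ₗ Matrix.toEuclideanLin B := by
    rw [map_sub, Matrix.toLpLin_mul_same, Matrix.toLpLin_mul_same]
  rw [hlin]
  refine sum_singularValues_comm_le (by simp) T hA.1.eigenvectorBasis hB.1.eigenvectorBasis
    hA.1.toEuclideanLin_eigenvectorBasis hB.1.toEuclideanLin_eigenvectorBasis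
    hA.eigenvalues_nonneg hB.eigenvalues_nonneg
    (orthonormal_sumElim_toLp hA.1.eigenvectorBasis.orthonormal hB.1.eigenvectorBasis.orthonormal)
    ?_ (by simpa using hl)
  rintro (i | i)
  · refine (WithLp.ofLp_injective 2) ?_
    rw [Matrix.ofLp_toLpLin, Matrix.toLin'_apply]
    have := hA.1.mulVec_eigenvectorBasis i
    funext p
    rcases p with p | p
    · simpa [matrixDirectSum, Matrix.fromBlocks_mulVec] using congrFun this p
    · simp [matrixDirectSum, Matrix.fromBlocks_mulVec]
  · refine (WithLp.ofLp_injective 2) ?_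
    rw [Matrix.ofLp_toLpLin, Matrix.toLin'_apply]
    have := hB.1.mulVec_eigenvectorBasis i
    funext p
    rcases p with p | p
    · simp [matrixDirectSum, Matrix.fromBlocks_mulVec]
    · simpa [matrixDirectSum, Matrix.fromBlocks_mulVec] using congrFun this p

/-! ### Contractions and monotonicity of unitarily invariant norms -/

section Contraction

/-- Each singular value `s ≤ 1` is the mean of the unimodular numbers `s ± i√(1 - s²)`; putting
these in place of `s` in the singular value decomposition gives two unitaries. -/
theorem LinearMap.exists_linearIsometryEquiv_average {E : Type*} [NormedAddCommGroup E]
    [InnerProductSpace ℂ E] [FiniteDimensional ℂ E] (T : E →ₗ[ℂ] E) (hT : ∀ x, ‖T x‖ ≤ ‖x‖) :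
    ∃ U V : E ≃ₗᵢ[ℂ] E, ∀ x, T x = (1 / 2 : ℂ) • (U x + V x) := by
  obtain ⟨e, f, hef⟩ := T.exists_orthonormalBasis_apply_eq_singularValues_smul rfl
  have hs1 : ∀ i : Fin (Module.finrank ℂ E), T.singularValues i ≤ 1 := by
    intro i
    have := hT (e i)
    rw [hef, norm_smul, f.norm_eq_one, e.norm_eq_one, mul_one, Complex.norm_real,
      Real.norm_of_nonneg (T.singularValues_nonneg _)] at this
    exact this
  have key : ∀ z : Fin (Module.finrank ℂ E) → ℂ, (∀ i, ‖z i‖ = 1) →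
      ∃ U : E ≃ₗᵢ[ℂ] E, ∀ i, U (e i) = z i • f i := by
    intro z hz
    have ho : Orthonormal ℂ fun i => z i • f i := by
      rw [orthonormal_iff_ite]
      intro i j
      rw [inner_smul_left, inner_smul_right, f.inner_eq_ite]
      split_ifs with h
      · subst h
        rw [mul_one, ← Complex.normSq_eq_conj_mul_self, Complex.normSq_eq_norm_sq, hz]
        simp
      · simp
    refine ⟨e.equiv (OrthonormalBasis.mk ho
      (ho.linearIndependent.span_eq_top_of_card_eq_finrank' (by simp)).ge) (Equiv.refl _),
      fun i => ?_⟩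
    rw [OrthonormalBasis.equiv_apply_basis]
    simp
  let t : Fin (Module.finrank ℂ E) → ℝ := fun i => √(1 - T.singularValues i ^ 2)
  have ht : ∀ i : Fin (Module.finrank ℂ E), T.singularValues i ^ 2 + t i ^ 2 = 1 := by
    intro i
    simp only [t]
    rw [Real.sq_sqrt]
    · ring
    · nlinarith [hs1 i, T.singularValues_nonneg i]
  obtain ⟨U, hU⟩ := key (fun i => ⟨T.singularValues i, t i⟩) fun i => by
    rw [Complex.norm_eq_sqrt_sq_add_sq, ht, Real.sqrt_one]
  obtain ⟨V, hV⟩ := key (fun i => ⟨T.singularValues i, -t i⟩) fun i => by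
    rw [Complex.norm_eq_sqrt_sq_add_sq, neg_sq, ht, Real.sqrt_one]
  refine ⟨U, V, fun x => ?_⟩
  have : T = (1 / 2 : ℂ) • ((U.toLinearEquiv : E →ₗ[ℂ] E) + (V.toLinearEquiv : E →ₗ[ℂ] E)) := by
    refine e.toBasis.ext fun i => ?_
    simp only [OrthonormalBasis.coe_toBasis, LinearMap.smul_apply, LinearMap.add_apply,
      LinearEquiv.coe_coe, LinearIsometryEquiv.coe_toLinearEquiv]
    rw [hef, hU, hV, ← add_smul, smul_smul]
    congr 1
    apply Complex.ext <;> simp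
    ring
  conv_lhs => rw [this]
  rfl

variable {ι : Type*} [Fintype ι] [DecidableEq ι]

theorem Matrix.exists_unitary_average {K : Matrix ι ι ℂ} (hK : matrixSpectralNorm K ≤ 1) :
    ∃ U ∈ Matrix.unitaryGroup ι ℂ, ∃ V ∈ Matrix.unitaryGroup ι ℂ, K = (1 / 2 : ℂ) • (U + V) := by
  obtain ⟨U, V, hUV⟩ := LinearMap.exists_linearIsometryEquiv_average
    (Matrix.toEuclideanCLM (𝕜 := ℂ) K : EuclideanSpace ℂ ι →ₗ[ℂ] EuclideanSpace ℂ ι) fun x =>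
      ((Matrix.toEuclideanCLM (𝕜 := ℂ) K).le_opNorm x).trans
        (mul_le_of_le_one_left (norm_nonneg _) hK)
  have hmem : ∀ W : EuclideanSpace ℂ ι ≃ₗᵢ[ℂ] EuclideanSpace ℂ ι,
      (Matrix.toEuclideanCLM (𝕜 := ℂ)).symm
        (Unitary.linearIsometryEquiv.symm W : _ →L[ℂ] _) ∈ Matrix.unitaryGroup ι ℂ := fun W =>
    Unitary.map_mem (Matrix.toEuclideanCLM (𝕜 := ℂ) (n := ι)).symm
      (Unitary.linearIsometryEquiv.symm W).2
  refine ⟨_, hmem U, _, hmem V, ?_⟩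
  apply EquivLike.injective (Matrix.toEuclideanCLM (𝕜 := ℂ) (n := ι))
  rw [map_smul, map_add, StarAlgEquiv.apply_symm_apply, StarAlgEquiv.apply_symm_apply]
  ext1 x
  exact hUV x

theorem matrixSpectralNorm_conjTranspose (K : Matrix ι ι ℂ) :
    matrixSpectralNorm K.conjTranspose = matrixSpectralNorm K := by
  rw [matrixSpectralNorm, ← Matrix.star_eq_conjTranspose, map_star,
    ContinuousLinearMap.star_eq_adjoint]
  exact ContinuousLinearMap.adjoint.norm_map _

theorem matrixSpectralNorm_le_one {K : Matrix ι ι ℂ}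
    (hK : (1 - K.conjTranspose * K).PosSemidef) : matrixSpectralNorm K ≤ 1 := by
  refine ContinuousLinearMap.opNorm_le_bound _ zero_le_one fun x => ?_
  rw [one_mul]
  refine le_of_sq_le_sq ?_ (norm_nonneg _)
  have h := hK.re_dotProduct_nonneg x.ofLp
  rw [Matrix.sub_mulVec, Matrix.one_mulVec, dotProduct_sub, ← Matrix.mulVec_mulVec,
    Matrix.dotProduct_mulVec, ← Matrix.star_mulVec, map_sub, sub_nonneg] at h
  have hsq : ∀ y : EuclideanSpace ℂ ι, ‖y‖ ^ 2 = RCLike.re (star y.ofLp ⬝ᵥ y.ofLp) := by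
    intro y
    rw [dotProduct_comm, ← EuclideanSpace.inner_eq_star_dotProduct,
      inner_self_eq_norm_sq_to_K]
    norm_cast
  rw [hsq, hsq]
  exact h

namespace IsUnitarilyInvariantNorm

variable {N : Seminorm ℂ (Matrix ι ι ℂ)} (hN : IsUnitarilyInvariantNorm N)
include hN

theorem unitary_mul {U : Matrix ι ι ℂ} (hU : U ∈ Matrix.unitaryGroup ι ℂ) (M : Matrix ι ι ℂ) :
    N (U * M) = N M := by
  simpa using hN.unitary_mul_mul_unitary M U 1 hU (one_mem _)

theorem mul_unitary {U : Matrix ι ι ℂ} (hU : U ∈ Matrix.unitaryGroup ι ℂ) (M : Matrix ι ι ℂ) :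
    N (M * U) = N M := by
  simpa using hN.unitary_mul_mul_unitary M 1 U (one_mem _) hU

theorem contraction_mul_le {K : Matrix ι ι ℂ} (hK : matrixSpectralNorm K ≤ 1)
    (M : Matrix ι ι ℂ) : N (K * M) ≤ N M := by
  obtain ⟨U, hU, V, hV, rfl⟩ := Matrix.exists_unitary_average hK
  rw [Matrix.smul_mul, add_mul, map_smul_eq_mul]
  have := map_add_le_add N (U * M) (V * M)
  rw [hN.unitary_mul hU, hN.unitary_mul hV] at this
  norm_num
  linarith

theorem mul_contraction_le {K : Matrix ι ι ℂ} (hK : matrixSpectralNorm K ≤ 1)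
    (M : Matrix ι ι ℂ) : N (M * K) ≤ N M := by
  obtain ⟨U, hU, V, hV, rfl⟩ := Matrix.exists_unitary_average hK
  rw [Matrix.mul_smul, mul_add, map_smul_eq_mul]
  have := map_add_le_add N (M * U) (M * V)
  rw [hN.mul_unitary hU, hN.mul_unitary hV] at this
  norm_num
  linarith

theorem conj_contraction_le {K : Matrix ι ι ℂ} (hK : matrixSpectralNorm K ≤ 1)
    (M : Matrix ι ι ℂ) : N (K * M * K.conjTranspose) ≤ N M :=
  (hN.mul_contraction_le ((matrixSpectralNorm_conjTranspose K).trans_le hK) _).trans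
    (hN.contraction_mul_le hK M)

/-- With `K = S^(1/2) T^(-1/2)`, the relation `S ≤ T` says `K*K ≤ 1`, while `K T K* = S`. -/
theorem le_of_posDef {S T : Matrix ι ι ℂ} (hS : S.PosSemidef) (hT : T.PosDef)
    (hST : (T - S).PosSemidef) : N S ≤ N T := by
  open scoped MatrixOrder in
  obtain ⟨G, hG, hGS⟩ : ∃ G : Matrix ι ι ℂ, G.conjTranspose = G ∧ G * G = S :=
    ⟨CFC.sqrt S, (Matrix.nonneg_iff_posSemidef.1 (CFC.sqrt_nonneg S)).isHermitian, CFC.sqrt_mul_sqrt_self S hS.nonneg⟩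
  open scoped MatrixOrder in
  obtain ⟨F, hF, hFT⟩ : ∃ F : Matrix ι ι ℂ, F.conjTranspose = F ∧ F * F = T :=
    ⟨CFC.sqrt T, (Matrix.nonneg_iff_posSemidef.1 (CFC.sqrt_nonneg T)).isHermitian,
      CFC.sqrt_mul_sqrt_self T hT.posSemidef.nonneg⟩
  have hFu : IsUnit F := isUnit_of_mul_isUnit_left (hFT ▸ hT.isUnit)
  have hdet : IsUnit F.det := (Matrix.isUnit_iff_isUnit_det F).1 hFu
  have hFi : F⁻¹.conjTranspose = F⁻¹ := by rw [Matrix.conjTranspose_nonsing_inv, hF]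
  have hK : matrixSpectralNorm (G * F⁻¹) ≤ 1 := by
    refine matrixSpectralNorm_le_one ?_
    have h := hST.conjTranspose_mul_mul_same F⁻¹
    have h2 : F⁻¹.conjTranspose * (T - S) * F⁻¹ = 1 - (G * F⁻¹).conjTranspose * (G * F⁻¹) := by
      rw [Matrix.conjTranspose_mul, hFi, hG, ← hFT, ← hGS, mul_sub, sub_mul, ← mul_assoc F⁻¹ F F,
        Matrix.nonsing_inv_mul F hdet, one_mul, Matrix.mul_nonsing_inv F hdet]
      simp only [mul_assoc]
    rwa [h2] at h
  have hSK : G * F⁻¹ * T * (G * F⁻¹).conjTranspose = S := by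
    rw [Matrix.conjTranspose_mul, hFi, hG, ← hFT, ← hGS, mul_assoc G, ← mul_assoc F⁻¹ F F,
      Matrix.nonsing_inv_mul F hdet, one_mul, mul_assoc G, ← mul_assoc F,
      Matrix.mul_nonsing_inv F hdet, one_mul]
  rw [← hSK]
  exact hN.conj_contraction_le hK T

theorem le_of_posSemidef {S T : Matrix ι ι ℂ} (hS : S.PosSemidef)
    (hST : (T - S).PosSemidef) : N S ≤ N T := by
  have hT : T.PosSemidef := by simpa using hST.add hS
  refine le_of_forall_pos_le_add fun δ hδ => ?_
  obtain ⟨ε, hε, hεδ⟩ : ∃ ε : ℝ, 0 < ε ∧ ε * N 1 ≤ δ := by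
    -- `T` is perturbed to the invertible `ε • 1 + T`; the `+ 1` avoids division by zero.
    refine ⟨δ / (N 1 + 1), by positivity, ?_⟩
    rw [div_mul_eq_mul_div, div_le_iff₀ (by positivity)]
    nlinarith [apply_nonneg N 1]
  have hε' : ((ε : ℂ) • (1 : Matrix ι ι ℂ)).PosDef :=
    Matrix.PosDef.one.smul (by exact_mod_cast hε)
  have h1 := hN.le_of_posDef hS (hε'.posSemidef_add hT) (by
    rw [add_sub_assoc, add_sub_left_comm]
    exact hε'.posSemidef.add hST)
  refine h1.trans ((map_add_le_add N _ _).trans ?_)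
  rw [map_smul_eq_mul, Complex.norm_real, Real.norm_of_nonneg hε.le]
  linarith

end IsUnitarilyInvariantNorm

end Contraction

/-! ### Block diagonal matrices -/

section DirectSum

variable {ι κ : Type*} [Fintype ι] [Fintype κ]

theorem matrixDirectSum_mul (A A' : Matrix ι ι ℂ) (B B' : Matrix κ κ ℂ) :
    matrixDirectSum A B * matrixDirectSum A' B' = matrixDirectSum (A * A') (B * B') := by
  simp [matrixDirectSum, Matrix.fromBlocks_multiply]

omit [Fintype ι] [Fintype κ] in
theorem matrixDirectSum_sub (A A' : Matrix ι ι ℂ) (B B' : Matrix κ κ ℂ) :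
    matrixDirectSum A B - matrixDirectSum A' B' = matrixDirectSum (A - A') (B - B') := by
  simp [matrixDirectSum, sub_eq_add_neg, Matrix.fromBlocks_neg, Matrix.fromBlocks_add]

theorem matrixDirectSum_mem_unitaryGroup [DecidableEq ι] [DecidableEq κ] {U : Matrix ι ι ℂ} {V : Matrix κ κ ℂ}
    (hU : U ∈ Matrix.unitaryGroup ι ℂ) (hV : V ∈ Matrix.unitaryGroup κ ℂ) :
    matrixDirectSum U V ∈ Matrix.unitaryGroup (ι ⊕ κ) ℂ := by
  rw [Matrix.mem_unitaryGroup_iff, Matrix.star_eq_conjTranspose] at *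
  rw [matrixDirectSum, Matrix.fromBlocks_conjTranspose, Matrix.fromBlocks_multiply]
  simp [hU, hV]

theorem Matrix.PosSemidef.matrixDirectSum {A : Matrix ι ι ℂ} {B : Matrix κ κ ℂ}
    (hA : A.PosSemidef) (hB : B.PosSemidef) : (matrixDirectSum A B).PosSemidef := by
  refine Matrix.PosSemidef.of_dotProduct_mulVec_nonneg ?_ fun x => ?_
  · simp [_root_.matrixDirectSum, Matrix.IsHermitian, Matrix.fromBlocks_conjTranspose, hA.1.eq,
      hB.1.eq]
  · rw [_root_.matrixDirectSum, Matrix.fromBlocks_mulVec]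
    simp only [dotProduct, Fintype.sum_sum_type, Matrix.zero_mulVec, add_zero, zero_add,
      Sum.elim_inl, Sum.elim_inr]
    exact add_nonneg (hA.dotProduct_mulVec_nonneg (x ∘ Sum.inl))
      (hB.dotProduct_mulVec_nonneg (x ∘ Sum.inr))

end DirectSum

/-! ### The norm inequality for `AX - XB` -/

section Commutator

variable {ι : Type*} [Fintype ι] [DecidableEq ι]

/-- The spectral projection of a Hermitian matrix on its positive part. -/
theorem Matrix.IsHermitian.exists_positive_projection {H : Matrix ι ι ℂ} (hH : H.IsHermitian) :
    ∃ P : Matrix ι ι ℂ, P.conjTranspose = P ∧ P * P = P ∧ P * H = H * P ∧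
      (P * H - (1 - P) * H).PosSemidef := by
  obtain ⟨W, hW, lam, hspec⟩ : ∃ W : Matrix ι ι ℂ, W.conjTranspose * W = 1 ∧ ∃ lam : ι → ℝ,
      H = W * Matrix.diagonal (fun i => (lam i : ℂ)) * W.conjTranspose :=
    ⟨hH.eigenvectorUnitary, Matrix.mem_unitaryGroup_iff'.1 hH.eigenvectorUnitary.2,
      hH.eigenvalues, hH.spectral_theorem⟩
  have hmul : ∀ d d' : ι → ℂ, W * Matrix.diagonal d * W.conjTranspose *
      (W * Matrix.diagonal d' * W.conjTranspose) =
        W * Matrix.diagonal (fun i => d i * d' i) * W.conjTranspose := by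
    intro d d'
    rw [← Matrix.diagonal_mul_diagonal]
    calc _ = W * Matrix.diagonal d * (W.conjTranspose * W) * Matrix.diagonal d' *
          W.conjTranspose := by simp only [mul_assoc]
      _ = _ := by rw [hW, mul_one]; simp only [mul_assoc]
  set p : ι → ℂ := fun i => if 0 < lam i then 1 else 0
  have hPH : W * Matrix.diagonal p * W.conjTranspose * H =
      W * Matrix.diagonal (fun i => p i * lam i) * W.conjTranspose := by
    conv_lhs => rw [hspec]
    exact hmul _ _
  refine ⟨W * Matrix.diagonal p * W.conjTranspose, ?_, ?_, ?_, ?_⟩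
  · rw [Matrix.conjTranspose_mul, Matrix.conjTranspose_mul, Matrix.conjTranspose_conjTranspose,
      Matrix.diagonal_conjTranspose, mul_assoc]
    congr 3
    funext i
    simp only [p, Pi.star_apply]
    split_ifs <;> simp
  · rw [hmul]
    congr 3
    funext i
    simp only [p]
    split_ifs <;> simp
  · rw [hPH]
    conv_rhs => rw [hspec, hmul]
    simp only [mul_comm]
  · have h : W * Matrix.diagonal p * W.conjTranspose * H -
        (1 - W * Matrix.diagonal p * W.conjTranspose) * H =
        W * Matrix.diagonal (fun i => ((|lam i| : ℝ) : ℂ)) * W.conjTranspose := by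
      rw [sub_mul, one_mul, hPH]
      conv_lhs => rw [hspec]
      simp only [← sub_mul, ← mul_sub, Matrix.diagonal_sub]
      congr 3
      funext i
      simp only [p]
      split_ifs with h
      · rw [abs_of_pos h]; simp
      · rw [abs_of_nonpos (not_lt.1 h)]; simp
    rw [h]
    refine Matrix.PosSemidef.mul_mul_conjTranspose_same (Matrix.PosSemidef.diagonal fun i => ?_) W
    simp

namespace IsUnitarilyInvariantNorm

variable {N : Seminorm ℂ (Matrix (ι ⊕ ι) (ι ⊕ ι) ℂ)} (hN : IsUnitarilyInvariantNorm N)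
include hN

/-- The unitary `P - Q`, where `Q = 1 - P`, turns `A - B` into `S = |A - B|`, and `T - S = PBP + QAQ
≥ 0`, so monotonicity gives `N(S ⊕ 0) ≤ N(T ⊕ 0)`. -/
theorem directSum_sub_zero_le {A B : Matrix ι ι ℂ} (hA : A.PosSemidef) (hB : B.PosSemidef) :
    N (matrixDirectSum (A - B) (0 : Matrix ι ι ℂ)) ≤ N (matrixDirectSum A B) := by
  obtain ⟨P, hPs, hPP, hPH, hpos⟩ := (hA.1.sub hB.1).exists_positive_projection
  have hQs : (1 - P).conjTranspose = 1 - P := by simp [hPs]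
  have hQQ : (1 - P) * (1 - P) = 1 - P := by simp [mul_sub, sub_mul, hPP]
  have hJ : P - (1 - P) ∈ Matrix.unitaryGroup ι ℂ := by
    rw [Matrix.mem_unitaryGroup_iff, Matrix.star_eq_conjTranspose, Matrix.conjTranspose_sub, hQs,
      hPs]
    simp only [mul_sub, sub_mul, hPP, mul_one, one_mul]
    abel
  set S := P * (A - B) - (1 - P) * (A - B) with hSdef
  set T := P * A * P + (1 - P) * B * (1 - P)
  have hS : matrixDirectSum (P - (1 - P)) (1 : Matrix ι ι ℂ) *
      matrixDirectSum (A - B) (0 : Matrix ι ι ℂ) = matrixDirectSum S (0 : Matrix ι ι ℂ) := by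
    rw [matrixDirectSum_mul, sub_mul, mul_zero]
  have hTS : T - S = P * B * P + (1 - P) * A * (1 - P) := by
    have h1 : P * (A - B) = P * (A - B) * P := by
      rw [mul_assoc, ← hPH, ← mul_assoc, hPP]
    have h2 : (1 - P) * (A - B) = (1 - P) * (A - B) * (1 - P) := by
      have : (A - B) * (1 - P) = (1 - P) * (A - B) := by
        rw [mul_sub (A - B), sub_mul 1, hPH, mul_one, one_mul]
      rw [mul_assoc, this, ← mul_assoc, hQQ]
    rw [hSdef, h1, h2]
    simp only [T]
    noncomm_ring
  have hconj : ∀ {M Q : Matrix ι ι ℂ}, M.PosSemidef → Q.conjTranspose = Q →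
      (Q * M * Q).PosSemidef := by
    intro M Q hM hQ
    simpa [hQ] using hM.conjTranspose_mul_mul_same Q
  have hmono : N (matrixDirectSum S (0 : Matrix ι ι ℂ)) ≤
      N (matrixDirectSum T (0 : Matrix ι ι ℂ)) := by
    refine hN.le_of_posSemidef (hpos.matrixDirectSum Matrix.PosSemidef.zero) ?_
    have : matrixDirectSum T (0 : Matrix ι ι ℂ) - matrixDirectSum S (0 : Matrix ι ι ℂ) =
        matrixDirectSum (T - S) (0 : Matrix ι ι ℂ) := by
      rw [matrixDirectSum_sub, sub_zero]
    rw [this, hTS]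
    exact ((hconj hB hPs).add (hconj hA hQs)).matrixDirectSum Matrix.PosSemidef.zero
  -- The row `(P, Q)` is a contraction because `KK* = 1 ⊕ 0`, and conjugation by it sends `A ⊕ B` to
  -- `T ⊕ 0`.
  set K : Matrix (ι ⊕ ι) (ι ⊕ ι) ℂ := Matrix.fromBlocks P (1 - P) 0 0
  have hKs : K.conjTranspose = Matrix.fromBlocks P 0 (1 - P) 0 := by
    rw [Matrix.fromBlocks_conjTranspose, hPs, hQs, Matrix.conjTranspose_zero]
  have hK : matrixSpectralNorm K ≤ 1 := by
    rw [← matrixSpectralNorm_conjTranspose]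
    refine matrixSpectralNorm_le_one ?_
    have : 1 - K.conjTranspose.conjTranspose * K.conjTranspose =
        matrixDirectSum (0 : Matrix ι ι ℂ) 1 := by
      rw [Matrix.conjTranspose_conjTranspose, hKs, Matrix.fromBlocks_multiply,
        hPP, hQQ, sub_eq_iff_eq_add, ← Matrix.fromBlocks_one]
      simp [matrixDirectSum, Matrix.fromBlocks_add]
    rw [this]
    exact Matrix.PosSemidef.zero.matrixDirectSum Matrix.PosSemidef.one
  have hKT : K * matrixDirectSum A B * K.conjTranspose = matrixDirectSum T (0 : Matrix ι ι ℂ) := by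
    rw [hKs, matrixDirectSum, Matrix.fromBlocks_multiply, Matrix.fromBlocks_multiply]
    simp [matrixDirectSum, T]
  calc N (matrixDirectSum (A - B) (0 : Matrix ι ι ℂ))
      = N (matrixDirectSum S (0 : Matrix ι ι ℂ)) := by
        rw [← hS, hN.unitary_mul (matrixDirectSum_mem_unitaryGroup hJ (one_mem _))]
    _ ≤ N (matrixDirectSum T (0 : Matrix ι ι ℂ)) := hmono
    _ ≤ N (matrixDirectSum A B) := hKT ▸ hN.conj_contraction_le hK _

theorem directSum_comm_unitary_le {A B U : Matrix ι ι ℂ} (hA : A.PosSemidef) (hB : B.PosSemidef)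
    (hU : U ∈ Matrix.unitaryGroup ι ℂ) :
    N (matrixDirectSum (A * U - U * B) (0 : Matrix ι ι ℂ)) ≤ N (matrixDirectSum A B) := by
  have hU1 : U.conjTranspose * U = 1 := Matrix.mem_unitaryGroup_iff'.1 hU
  have hUs : U.conjTranspose ∈ Matrix.unitaryGroup ι ℂ := Unitary.star_mem hU
  have h1 : matrixDirectSum (A * U - U * B) (0 : Matrix ι ι ℂ) =
      matrixDirectSum (A - U * B * U.conjTranspose) (0 : Matrix ι ι ℂ) *
        matrixDirectSum U (1 : Matrix ι ι ℂ) := by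
    rw [matrixDirectSum_mul, zero_mul, sub_mul, mul_assoc _ U.conjTranspose, hU1, mul_one]
  have h2 : matrixDirectSum A (U * B * U.conjTranspose) =
      matrixDirectSum (1 : Matrix ι ι ℂ) U * matrixDirectSum A B *
        matrixDirectSum (1 : Matrix ι ι ℂ) U.conjTranspose := by
    rw [matrixDirectSum_mul, matrixDirectSum_mul, one_mul, mul_one]
  rw [h1, hN.mul_unitary (matrixDirectSum_mem_unitaryGroup hU (one_mem _))]
  refine (hN.directSum_sub_zero_le hA (hB.mul_mul_conjTranspose_same U)).trans_eq ?_
  rw [h2, hN.unitary_mul_mul_unitary _ _ _ (matrixDirectSum_mem_unitaryGroup (one_mem _) hU)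
    (matrixDirectSum_mem_unitaryGroup (one_mem _) hUs)]

theorem directSum_comm_le {A B : Matrix ι ι ℂ} (X : Matrix ι ι ℂ) (hA : A.PosSemidef)
    (hB : B.PosSemidef) :
    N (matrixDirectSum (A * X - X * B) (0 : Matrix ι ι ℂ)) ≤
      matrixSpectralNorm X * N (matrixDirectSum A B) := by
  have hadd : ∀ Y Z : Matrix ι ι ℂ, matrixDirectSum (Y + Z) (0 : Matrix ι ι ℂ) =
      matrixDirectSum Y (0 : Matrix ι ι ℂ) + matrixDirectSum Z (0 : Matrix ι ι ℂ) := by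
    intro Y Z
    simp [matrixDirectSum, Matrix.fromBlocks_add]
  have hsmul : ∀ (z : ℂ) (Y : Matrix ι ι ℂ), matrixDirectSum (z • Y) (0 : Matrix ι ι ℂ) =
      z • matrixDirectSum Y (0 : Matrix ι ι ℂ) := by
    intro z Y
    simp [matrixDirectSum, Matrix.fromBlocks_smul]
  have hnorm0 : 0 ≤ matrixSpectralNorm X := norm_nonneg _
  -- The case `X = 0` is separated so that `X` can be divided by its norm; `AX - XB` is linear in
  -- `X`, so averaging over two unitaries finishes.
  rcases hnorm0.eq_or_lt with h0 | hpos
  · have hX : X = 0 := by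
      have : Matrix.toEuclideanCLM (𝕜 := ℂ) X = 0 := norm_eq_zero.1 h0.symm
      exact (map_eq_zero_iff _ (EquivLike.injective (Matrix.toEuclideanCLM (𝕜 := ℂ) (n := ι)))).1 this
    have h00 : matrixDirectSum (0 : Matrix ι ι ℂ) (0 : Matrix ι ι ℂ) = 0 := by
      simp [matrixDirectSum]
    rw [← h0, hX, mul_zero, zero_mul, sub_zero, h00, map_zero, zero_mul]
  · set t := matrixSpectralNorm X
    have ht : (t : ℂ) ≠ 0 := by exact_mod_cast hpos.ne'
    have hK : matrixSpectralNorm ((t : ℂ)⁻¹ • X) ≤ 1 := by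
      rw [matrixSpectralNorm, map_smul, norm_smul, norm_inv, Complex.norm_real,
        Real.norm_of_nonneg hpos.le]
      exact (inv_mul_cancel₀ hpos.ne').le
    obtain ⟨U, hU, V, hV, hUV⟩ := Matrix.exists_unitary_average hK
    have hX : X = ((t : ℂ) * (1 / 2)) • (U + V) := by
      rw [mul_smul, ← hUV, smul_smul, mul_inv_cancel₀ ht, one_smul]
    have hcomm : A * X - X * B = ((t : ℂ) * (1 / 2)) • ((A * U - U * B) + (A * V - V * B)) := by
      rw [hX, Matrix.mul_smul, Matrix.smul_mul, ← smul_sub, mul_add, add_mul]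
      congr 1
      abel
    rw [hcomm, hsmul, hadd, map_smul_eq_mul, norm_mul, Complex.norm_real,
      Real.norm_of_nonneg hpos.le, mul_assoc]
    refine mul_le_mul_of_nonneg_left ?_ hpos.le
    have h1 := hN.directSum_comm_unitary_le hA hB hU
    have h2 := hN.directSum_comm_unitary_le hA hB hV
    have h3 := map_add_le_add N (matrixDirectSum (A * U - U * B) (0 : Matrix ι ι ℂ))
      (matrixDirectSum (A * V - V * B) (0 : Matrix ι ι ℂ))
    norm_num
    linarith

end IsUnitarilyInvariantNorm

end Commutator

theorem corollary3p3 (n : ℕ) (A B X : Matrix (Fin n) (Fin n) ℂ)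
    (hA : A.PosSemidef) (hB : B.PosSemidef) :
    Submajorized (singularVector (A * X - X * B))
      (entrywiseMul (singularVector X) (singularVector (matrixDirectSum A B))) ∧
    ∀ N : Seminorm ℂ (Matrix (Fin n ⊕ Fin n) (Fin n ⊕ Fin n) ℂ),
      IsUnitarilyInvariantNorm N →
        N (matrixDirectSum (A * X - X * B) (0 : Matrix (Fin n) (Fin n) ℂ)) ≤
          matrixSpectralNorm X * N (matrixDirectSum A B) :=
  ⟨submajorized_singularVector_comm n A B X hA hB, fun _ hN => hN.directSum_comm_le X hA hB⟩
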